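/- All graphs are finite and simple. For a graph $G$ without isolated vertices, a set $S\subseteq V(G)$ is a *total dominating set* if every vertex of $G$ is adjacent to a vertex of $S$; it is a *semitotal dominating set* if every vertex of $V(G)\setminus S$ is adjacent to a vertex of $S$ and every vertex of $S$ is within distance $2$ of another vertex of $S$. Let $\gamma_t(G)$ and $\gamma_{t2}(G)$ denote the minimum cardinalities of a total dominating set and of a semitotal dominating set of $G$, respectively. A *labeling* of a tree $T$ assigns to each vertex one of the statuses $A,B,C,D$. Let $\mathscr{T}_1$ be the smallest family of labeled trees (up to isomorphism) that contains the path $P_5$ with vertices labeled $C,B,D,A,C$ in order along the path, and is closed under the following two operations, applied to a vertex $v$ of a labeled tree in the family: * $\mathscr{O}_1$: if $v$ has status $A$ or $B$, add a new vertex $u$ with status $C$ and the edge $uv$; * $\mathscr{O}_3$: if $v$ has status $A$, add a new path $u_1u_2u_3$ and the edge $u_1v$, where $u_1,u_2,u_3$ have status $D,B,C$, respectively. **Theorem.** For every tree $T$ with at least two vertices, $\gamma_t(T)\le 2\gamma_{t2}(T)-1$. Moreover, $\gamma_t(T)=2\gamma_{t2}(T)-1$ if and only if $(T,S')\in\mathscr{T}_1$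 for some labeling $S'$ of $T$. -/

import Mathlib

open scoped SimpleGraph

universe u

/-- `S` is a total dominating set of `G`: every vertex of `G` is adjacent to a vertex of `S`. -/
def IsTotalDominatingSet {V : Type u} (G : SimpleGraph V) (S : Finset V) : Prop :=
  ∀ v : V, ∃ w ∈ S, G.Adj v w

/-- `S` is a dominating set of `G`: every vertex outside `S` is adjacent to a vertex of `S`. -/
def IsDominatingSet {V : Type u} (G : SimpleGraph V) (S : Finset V) : Prop :=
  ∀ v : V, v ∉ S → ∃ w ∈ S, G.Adj v w

/-- `S` is a semitotal dominating set of `G`: it is dominating, and every vertex of `S` is within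
distance `2` of another vertex of `S`. The extended distance is infinite between vertices of
different components. -/
def IsSemitotalDominatingSet {V : Type u} (G : SimpleGraph V) (S : Finset V) : Prop :=
  IsDominatingSet G S ∧ ∀ v ∈ S, ∃ w ∈ S, w ≠ v ∧ G.edist v w ≤ 2

/-- The total domination number: the minimum cardinality of a total dominating set.
(Such sets exist in every finite graph without isolated vertices.) -/
noncomputable def totalDominationNumber {V : Type u} (G : SimpleGraph V) : ℕ :=
  sInf {k : ℕ | ∃ S : Finset V, IsTotalDominatingSet G S ∧ S.card = k}

/-- The semitotal domination number: the minimum cardinality of a semitotal dominating set.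
(Such sets exist in every finite graph without isolated vertices.) -/
noncomputable def semitotalDominationNumber {V : Type u} (G : SimpleGraph V) : ℕ :=
  sInf {k : ℕ | ∃ S : Finset V, IsSemitotalDominatingSet G S ∧ S.card = k}

/-- The statuses of vertices. A labeling `V → Status` is the same as a partition of `V` into
four (possibly empty) classes. -/
inductive Status : Type
  | A
  | B
  | C
  | D

/-- The graph obtained from the disjoint union of `G` and the path with vertices
`0, 1, …, n` by adding the edge between `v` and the end vertex `0` of the path. -/
def attachPath {V : Type u} (G : SimpleGraph V) (v : V) (n : ℕ) :
    SimpleGraph (V ⊕ Fin (n + 1)) :=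
  (G ⊕g SimpleGraph.pathGraph (n + 1)) ⊔ SimpleGraph.edge (Sum.inl v) (Sum.inr 0)

/-- The family of labeled trees (taken up to isomorphism of labeled graphs) that contains the path
on five vertices labeled `C, B, D, A, C` in order and is closed under two operations: joining one
new vertex with status `C` to a vertex with status `A` or `B`, and joining the first vertex of a
new path on three vertices labeled `D, B, C` in order to a vertex with status `A`. -/
inductive FamilyT1 : {V : Type u} → SimpleGraph V → (V → Status) → Prop
  | base {V : Type u} {G : SimpleGraph V} {sta : V → Status}
      (e : SimpleGraph.pathGraph 5 ≃g G)
      (he : ∀ i, sta (e i) = ![Status.C, Status.B, Status.D, Status.A, Status.C] i) :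
      FamilyT1 G sta
  | addLeaf {V : Type u} {G : SimpleGraph V} {sta : V → Status} (h : FamilyT1 G sta)
      (v : V) (hv : sta v = Status.A ∨ sta v = Status.B) :
      FamilyT1 (attachPath G v 0) (Sum.elim sta ![Status.C])
  | addPath {V : Type u} {G : SimpleGraph V} {sta : V → Status} (h : FamilyT1 G sta)
      (v : V) (hv : sta v = Status.A) :
      FamilyT1 (attachPath G v 2) (Sum.elim sta ![Status.D, Status.B, Status.C])
  | iso {V W : Type u} {G : SimpleGraph V} {H : SimpleGraph W} {sta : V → Status}
      {sta' : W → Status} (h : FamilyT1 G sta) (e : G ≃g H) (he : ∀ v, sta' (e v) = sta v) :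
      FamilyT1 H sta'

/-! ### The upper bound and the local consequences of equality -/

section Domination

variable {V : Type u} {G : SimpleGraph V}

/-! Adding one neighbour of each vertex to a semitotal dominating set `S` gives a total dominating
set of size at most `2|S|`. Two vertices of `S` within distance 2 save at least one: they dominate
each other or can share an added neighbour. This is the bound.

If equality holds, no second saving is possible (`exists_isTotalDominatingSet_card_add_card_le`
counts savings). So `S` is independent, no three of its vertices share a neighbour, and no two
disjoint pairs in `S` have common neighbours. The pairs with a common neighbour therefore pairwise
meet and cover `S`, which yields a center `a` paired with every other `b ∈ S` through its own middle
vertex `d b`. Joining each remaining vertex to a dominator in `S` gives a connected spanning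
subgraph, hence the whole tree. Minimality forces a leaf at each vertex of `S`. Such a tree is
assembled from `P₅` by adding branches and leaves.

Conversely, in a member of the family the vertices of status `A` or `B` form a semitotal dominating
set of size `|B| + 1`. Leaves force all of them into every total dominating set, which also needs a
separate further vertex next to each `B`. Hence `γ_t ≥ 2|B| + 1`. -/

theorem totalDominationNumber_le_card {S : Finset V} (hS : IsTotalDominatingSet G S) :
    totalDominationNumber G ≤ S.card :=
  Nat.sInf_le ⟨S, hS, rfl⟩

theorem semitotalDominationNumber_le_card {S : Finset V} (hS : IsSemitotalDominatingSet G S) :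
    semitotalDominationNumber G ≤ S.card :=
  Nat.sInf_le ⟨S, hS, rfl⟩

theorem exists_isTotalDominatingSet_card_eq [Finite V] (hG : ∀ v, ∃ w, G.Adj v w) :
    ∃ S : Finset V, IsTotalDominatingSet G S ∧ S.card = totalDominationNumber G := by
  have := Fintype.ofFinite V
  refine Nat.sInf_mem (s := {k | ∃ S : Finset V, IsTotalDominatingSet G S ∧ S.card = k})
    ⟨_, Finset.univ, fun v => ?_, rfl⟩
  simpa using hG v

theorem exists_isSemitotalDominatingSet_card_eq [Finite V] (hG : ∀ v, ∃ w, G.Adj v w) :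
    ∃ S : Finset V, IsSemitotalDominatingSet G S ∧ S.card = semitotalDominationNumber G := by
  have := Fintype.ofFinite V
  refine Nat.sInf_mem (s := {k | ∃ S : Finset V, IsSemitotalDominatingSet G S ∧ S.card = k})
    ⟨_, Finset.univ, ⟨fun v hv => absurd (Finset.mem_univ v) hv, fun v _ => ?_⟩, rfl⟩
  obtain ⟨w, hw⟩ := hG v
  refine ⟨w, Finset.mem_univ w, hw.ne', ?_⟩
  rw [SimpleGraph.edist_eq_one_iff_adj.2 hw]
  norm_num

theorem edist_le_two_iff {v w : V} (hne : v ≠ w) :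
    G.edist v w ≤ 2 ↔ G.Adj v w ∨ ∃ x, G.Adj v x ∧ G.Adj w x := by
  rw [← not_lt, SimpleGraph.two_lt_edist_iff]
  simp only [ne_eq, hne, not_false_eq_true, true_and, not_and_or, not_not,
    ← Set.nonempty_iff_ne_empty, Set.Nonempty, SimpleGraph.mem_commonNeighbors]

/-- If the vertices of a subset `S₀` of a dominating set `S` have neighbours in `S ∪ X`, then
`S ∪ X` together with one neighbour for each vertex of `S \ S₀` is a total dominating set. -/
theorem exists_isTotalDominatingSet_card_add_card_le {S S₀ X : Finset V}
    (hG : ∀ v, ∃ w, G.Adj v w) (hS : IsDominatingSet G S) (h₀ : S₀ ⊆ S)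
    (hX : ∀ v ∈ S₀, ∃ w, (w ∈ S ∨ w ∈ X) ∧ G.Adj v w) :
    ∃ D : Finset V, IsTotalDominatingSet G D ∧ D.card + S₀.card ≤ 2 * S.card + X.card := by
  classical
  choose c hc using hG
  refine ⟨S ∪ X ∪ (S \ S₀).image c, fun v => ?_, ?_⟩
  · by_cases hv : v ∈ S
    · by_cases hv₀ : v ∈ S₀
      · obtain ⟨w, hw, hvw⟩ := hX v hv₀
        exact ⟨w, by simp only [Finset.mem_union]; tauto, hvw⟩
      · exact ⟨c v, Finset.mem_union_right _
          (Finset.mem_image_of_mem c (Finset.mem_sdiff.2 ⟨hv, hv₀⟩)), hc v⟩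
    · obtain ⟨w, hw, hvw⟩ := hS v hv
      exact ⟨w, by simp only [Finset.mem_union]; tauto, hvw⟩
  · have h1 := Finset.card_union_le (S ∪ X) ((S \ S₀).image c)
    have h2 := Finset.card_union_le S X
    have h3 : ((S \ S₀).image c).card ≤ (S \ S₀).card := Finset.card_image_le
    have h4 := Finset.card_sdiff_add_card_eq_card h₀
    omega

theorem totalDominationNumber_add_card_le {S S₀ X : Finset V}
    (hG : ∀ v, ∃ w, G.Adj v w) (hS : IsDominatingSet G S) (h₀ : S₀ ⊆ S)
    (hX : ∀ v ∈ S₀, ∃ w, (w ∈ S ∨ w ∈ X) ∧ G.Adj v w) :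
    totalDominationNumber G + S₀.card ≤ 2 * S.card + X.card := by
  obtain ⟨D, hD, hcard⟩ := exists_isTotalDominatingSet_card_add_card_le hG hS h₀ hX
  have := totalDominationNumber_le_card hD
  omega

/-- An adjacent pair in `S` needs no added neighbours, saving two; a pair with a common neighbour
needs only that one, saving one. -/
theorem IsSemitotalDominatingSet.totalDominationNumber_lt [Nonempty V] {S : Finset V}
    (hG : ∀ v, ∃ w, G.Adj v w) (hS : IsSemitotalDominatingSet G S) :
    totalDominationNumber G < 2 * S.card := by
  classical
  obtain ⟨v, hv⟩ : ∃ v, v ∈ S := by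
    obtain ⟨x⟩ := ‹Nonempty V›
    by_cases hx : x ∈ S
    · exact ⟨x, hx⟩
    · obtain ⟨w, hw, -⟩ := hS.1 x hx
      exact ⟨w, hw⟩
  obtain ⟨w, hw, hwv, hd⟩ := hS.2 v hv
  have hsub : ({v, w} : Finset V) ⊆ S := by
    simp [Finset.insert_subset_iff, hv, hw]
  have hc : ({v, w} : Finset V).card = 2 := Finset.card_pair hwv.symm
  rcases (edist_le_two_iff hwv.symm).1 hd with h | ⟨x, hvx, hwx⟩
  · have := totalDominationNumber_add_card_le (X := ∅) hG hS.1 hsub (by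
      simp only [Finset.mem_insert, Finset.mem_singleton]
      rintro y (rfl | rfl)
      · exact ⟨w, Or.inl hw, h⟩
      · exact ⟨v, Or.inl hv, h.symm⟩)
    simp only [hc, Finset.card_empty] at this
    omega
  · have := totalDominationNumber_add_card_le (X := {x}) hG hS.1 hsub (by
      simp only [Finset.mem_insert, Finset.mem_singleton]
      rintro y (rfl | rfl)
      · exact ⟨x, Or.inr rfl, hvx⟩
      · exact ⟨x, Or.inr rfl, hwx⟩)
    simp only [hc, Finset.card_singleton] at this
    omega

theorem totalDominationNumber_lt_two_mul_semitotalDominationNumber [Finite V] [Nonempty V]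
    (hG : ∀ v, ∃ w, G.Adj v w) :
    totalDominationNumber G < 2 * semitotalDominationNumber G := by
  obtain ⟨S, hS, hc⟩ := exists_isSemitotalDominatingSet_card_eq hG
  exact hc ▸ hS.totalDominationNumber_lt hG

/-- If twice the size of a semitotal dominating set exceeds the total domination number by one,
then the set is independent. -/
theorem IsSemitotalDominatingSet.not_adj {S : Finset V} (hG : ∀ v, ∃ w, G.Adj v w)
    (hS : IsSemitotalDominatingSet G S) (heq : totalDominationNumber G + 1 = 2 * S.card)
    {v w : V} (hv : v ∈ S) (hw : w ∈ S) : ¬ G.Adj v w := by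
  classical
  intro h
  have := totalDominationNumber_add_card_le (S₀ := {v, w}) (X := ∅) hG hS.1
    (by simp [Finset.insert_subset_iff, hv, hw]) (by
      simp only [Finset.mem_insert, Finset.mem_singleton]
      rintro y (rfl | rfl)
      · exact ⟨w, Or.inl hw, h⟩
      · exact ⟨v, Or.inl hv, h.symm⟩)
  simp only [Finset.card_pair h.ne, Finset.card_empty] at this
  omega

/-- One added vertex serving three vertices of `S` would save two. -/
theorem IsSemitotalDominatingSet.not_adj_of_three {S : Finset V} (hG : ∀ v, ∃ w, G.Adj v w)
    (hS : IsSemitotalDominatingSet G S) (heq : totalDominationNumber G + 1 = 2 * S.card)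
    {v w u x : V} (hv : v ∈ S) (hw : w ∈ S) (hu : u ∈ S) (hvw : v ≠ w) (hvu : v ≠ u) (hwu : w ≠ u)
    (hvx : G.Adj v x) (hwx : G.Adj w x) : ¬ G.Adj u x := by
  classical
  intro h
  have := totalDominationNumber_add_card_le (S₀ := {v, w, u}) (X := {x}) hG hS.1
    (by simp [Finset.insert_subset_iff, hv, hw, hu]) (by
      simp only [Finset.mem_insert, Finset.mem_singleton]
      rintro y (rfl | rfl | rfl) <;> exact ⟨x, Or.inr rfl, ‹_›⟩)
  rw [Finset.card_eq_three.2 ⟨v, w, u, hvw, hvu, hwu, rfl⟩, Finset.card_singleton] at this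
  omega

/-- Two disjoint pairs would save one each. -/
theorem IsSemitotalDominatingSet.not_two_disjoint_pairs {S : Finset V} (hG : ∀ v, ∃ w, G.Adj v w)
    (hS : IsSemitotalDominatingSet G S) (heq : totalDominationNumber G + 1 = 2 * S.card)
    {v w v' w' x x' : V} (hv : v ∈ S) (hw : w ∈ S) (hv' : v' ∈ S) (hw' : w' ∈ S)
    (hvw : v ≠ w) (hvw' : v' ≠ w') (hvx : G.Adj v x) (hwx : G.Adj w x)
    (hvx' : G.Adj v' x') (hwx' : G.Adj w' x') : v = v' ∨ v = w' ∨ w = v' ∨ w = w' := by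
  classical
  by_contra! hne
  have := totalDominationNumber_add_card_le (S₀ := {v, w, v', w'}) (X := {x, x'}) hG hS.1
    (by simp [Finset.insert_subset_iff, hv, hw, hv', hw']) (by
      simp only [Finset.mem_insert, Finset.mem_singleton]
      rintro y (rfl | rfl | rfl | rfl)
      · exact ⟨x, by simp, hvx⟩
      · exact ⟨x, by simp, hwx⟩
      · exact ⟨x', by simp, hvx'⟩
      · exact ⟨x', by simp, hwx'⟩)
  have h4 : ({v, w, v', w'} : Finset V).card = 4 := by
    rw [Finset.card_insert_of_notMem (by simp [hvw, hne]),
      Finset.card_insert_of_notMem (by simp [hne]), Finset.card_pair hvw']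
  have h2 : ({x, x'} : Finset V).card ≤ 2 := Finset.card_le_two
  omega

/-- In the extremal case some vertex of the semitotal dominating set has a common neighbour with
each of the other ones. -/
theorem IsSemitotalDominatingSet.exists_center [Nonempty V] {S : Finset V}
    (hG : ∀ v, ∃ w, G.Adj v w) (hS : IsSemitotalDominatingSet G S)
    (heq : totalDominationNumber G + 1 = 2 * S.card) :
    ∃ a ∈ S, (∃ b ∈ S, b ≠ a) ∧ ∀ w ∈ S, w ≠ a → ∃ x, G.Adj a x ∧ G.Adj w x := by
  have hmate : ∀ v ∈ S, ∃ w ∈ S, w ≠ v ∧ ∃ x, G.Adj v x ∧ G.Adj w x := by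
    intro v hv
    obtain ⟨w, hw, hwv, hd⟩ := hS.2 v hv
    exact ⟨w, hw, hwv, ((edist_le_two_iff hwv.symm).1 hd).resolve_left (hS.not_adj hG heq hv hw)⟩
  obtain ⟨v, hv⟩ : ∃ v, v ∈ S := by
    rw [← Finset.Nonempty, ← Finset.card_pos]
    omega
  by_cases hcen : ∀ w ∈ S, w ≠ v → ∃ x, G.Adj v x ∧ G.Adj w x
  · obtain ⟨w, hw, hwv, -⟩ := hmate v hv
    exact ⟨v, hv, ⟨w, hw, hwv⟩, hcen⟩
  push Not at hcen
  obtain ⟨w, hw, hwv, hno⟩ := hcen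
  obtain ⟨a, ha, hav, x, hvx, hax⟩ := hmate v hv
  obtain ⟨a', ha', haw', x', hwx', hax'⟩ := hmate w hw
  -- The pairs `{v, a}` and `{w, a'}` must meet, and `v`, `w` have no common neighbour, so their
  -- partners coincide; this partner is the center.
  obtain rfl : a = a' := by
    rcases hS.not_two_disjoint_pairs hG heq hv ha hw ha' hav.symm haw'.symm hvx hax hwx' hax' with
      rfl | rfl | rfl | rfl
    · exact absurd rfl hwv
    · exact absurd hwx' (hno _ hax')
    · exact absurd hax (hno _ hvx)
    · rfl
  refine ⟨a, ha, ⟨v, hv, hav.symm⟩, fun u hu hua => ?_⟩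
  obtain ⟨u', hu', huu', y, huy, huy'⟩ := hmate u hu
  by_cases hu'a : u' = a
  · subst hu'a
    exact ⟨y, huy', huy⟩
  by_cases huv : u = v
  · subst huv
    exact ⟨x, hax, hvx⟩
  by_cases huw : u = w
  · subst huw
    exact ⟨x', hax', hwx'⟩
  -- A pair `{u, u'}` avoiding `a` must meet both `{v, a}` and `{w, a}`, so `u'` would equal both
  -- `v` and `w`.
  have h1 := hS.not_two_disjoint_pairs hG heq hu hu' hv ha huu'.symm hav.symm huy huy' hvx hax
  have h2 := hS.not_two_disjoint_pairs hG heq hu hu' hw ha huu'.symm haw'.symm huy huy' hwx' hax'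
  simp only [huv, hua, hu'a, huw, false_or, or_false] at h1 h2
  exact absurd (h2.symm.trans h1) hwv

end Domination

/-! ### The structure of extremal trees -/

section LeafedStar

variable {V : Type u}

/-- The labeled graph consists of a center `a` with status `A`, of branches `a - d - b` with `d` and
`b` of status `D` and `B`, and of leaves of status `C` attached to `a` and to the end vertices of
the branches. The map `p` sends a vertex to the next vertex on the way to the center. -/
structure IsLeafedSubdividedStar (G : SimpleGraph V) (sta : V → Status) (p : V → V) (a : V) :
    Prop where
  adj_iff : ∀ x y, G.Adj x y ↔ x ≠ y ∧ (p x = y ∨ p y = x)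
  parent_center : p a = a
  status_eq_A_iff : ∀ x, sta x = Status.A ↔ x = a
  parent_of_D : ∀ x, sta x = Status.D → p x = a
  parent_of_B : ∀ x, sta x = Status.B → sta (p x) = Status.D
  parent_of_C : ∀ x, sta x = Status.C → sta (p x) = Status.A ∨ sta (p x) = Status.B
  eq_of_parent_eq : ∀ x y, sta x = Status.B → sta y = Status.B → p x = p y → x = y
  exists_child_of_D : ∀ x, sta x = Status.D → ∃ b, sta b = Status.B ∧ p b = x
  exists_leaf : ∀ x, sta x = Status.A ∨ sta x = Status.B → ∃ c, sta c = Status.C ∧ p c = x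
  exists_D : ∃ x, sta x = Status.D

/-- The only connected spanning subgraph of a tree is the tree itself. -/
theorem SimpleGraph.IsTree.adj_iff_of_reachable {T : SimpleGraph V} (hT : T.IsTree) {p : V → V}
    {a : V} (hp : ∀ x, p x ≠ x → T.Adj x (p x)) (hreach : ∀ x, ∃ n, p^[n] x = a) (x y : V) :
    T.Adj x y ↔ x ≠ y ∧ (p x = y ∨ p y = x) := by
  set R : SimpleGraph V := SimpleGraph.fromRel fun x y => p x = y with hR
  have hRT : R ≤ T := by
    intro x y h
    rw [hR, SimpleGraph.fromRel_adj] at h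
    obtain ⟨hne, rfl | rfl⟩ := h
    · exact hp _ hne.symm
    · exact (hp _ hne).symm
  have hstep : ∀ x, R.Reachable x (p x) := by
    intro x
    by_cases h : p x = x
    · rw [h]
    · exact SimpleGraph.Adj.reachable ((SimpleGraph.fromRel_adj _ _ _).2 ⟨Ne.symm h, Or.inl rfl⟩)
  have hiter : ∀ n x, R.Reachable x (p^[n] x) := by
    intro n
    induction n with
    | zero => exact fun x => SimpleGraph.Reachable.refl x
    | succ n ih => exact fun x => (hstep x).trans (ih (p x))
  have hcenter : ∀ x, R.Reachable x a := by
    intro x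
    obtain ⟨n, hn⟩ := hreach x
    exact hn ▸ hiter n x
  have hconn : R.Connected :=
    (SimpleGraph.connected_iff _).2 ⟨fun x y => (hcenter x).trans (hcenter y).symm, ⟨a⟩⟩
  have hTR : T = R :=
    le_antisymm ((SimpleGraph.isTree_iff_minimal_connected.1 hT).2 hconn hRT) hRT
  rw [hTR, hR, SimpleGraph.fromRel_adj]

/-- A tree whose total domination number is one less than twice the size of a semitotal dominating
set is a subdivided star with leaves attached. -/
theorem IsSemitotalDominatingSet.exists_isLeafedSubdividedStar [Nonempty V] {T : SimpleGraph V}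
    (hT : T.IsTree) (hG : ∀ v, ∃ w, T.Adj v w) {S : Finset V} (hS : IsSemitotalDominatingSet T S)
    (heq : totalDominationNumber T + 1 = 2 * S.card) :
    ∃ (sta : V → Status) (p : V → V) (a : V), IsLeafedSubdividedStar T sta p a := by
  classical
  obtain ⟨a, ha, ⟨b₀, hb₀, hb₀a⟩, hcen⟩ := hS.exists_center hG heq
  choose! d had hbd using hcen
  have hd_notMem : ∀ b ∈ S, b ≠ a → d b ∉ S := fun b hb hba h =>
    hS.not_adj hG heq ha h (had b hb hba)
  have hd_inj : ∀ b ∈ S, b ≠ a → ∀ b' ∈ S, b' ≠ a → d b = d b' → b = b' := by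
    intro b hb hba b' hb' hba' h
    by_contra hne
    exact hS.not_adj_of_three hG heq ha hb hb' hba.symm hba'.symm hne (had b hb hba) (hbd b hb hba)
      (h ▸ hbd b' hb' hba')
  have hdom := hS.1
  choose! c hcS hcadj using hdom
  set M : V → Prop := fun x => ∃ b ∈ S, b ≠ a ∧ d b = x with hM
  have hMS : ∀ x, M x → x ∉ S := by
    rintro x ⟨b, hb, hba, rfl⟩
    exact hd_notMem b hb hba
  set sta : V → Status := fun x =>
    if x = a then Status.A else if x ∈ S then Status.B else if M x then Status.D else Status.C
    with hsta
  -- Here `c x ∈ S` is a chosen dominator of `x`; at most three steps of `p` lead to `a`.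
  set p : V → V := fun x => if x = a then a else if x ∈ S then d x else if M x then a else c x
    with hp
  have hA : ∀ x, sta x = Status.A ↔ x = a := by
    intro x
    by_cases hx : x = a
    · simp [hsta, hx]
    · by_cases hxS : x ∈ S
      · simp [hsta, hx, hxS]
      · by_cases hxM : M x <;> simp [hsta, hx, hxS, hxM]
  have hB : ∀ x, sta x = Status.B ↔ x ∈ S ∧ x ≠ a := by
    intro x
    by_cases hx : x = a
    · simp [hsta, hx]
    · by_cases hxS : x ∈ S
      · simp [hsta, hx, hxS]
      · by_cases hxM : M x <;> simp [hsta, hx, hxS, hxM]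
  have hD : ∀ x, sta x = Status.D ↔ M x := by
    intro x
    have := hMS x
    by_cases hx : x = a
    · subst hx
      simp only [hsta, if_true, reduceCtorEq, false_iff]
      exact fun h => this h ha
    · by_cases hxS : x ∈ S
      · simp only [hsta, hx, hxS, if_true, if_false, reduceCtorEq, false_iff]
        exact fun h => this h hxS
      · by_cases hxM : M x <;> simp [hsta, hx, hxS, hxM]
  have hC : ∀ x, sta x = Status.C ↔ x ∉ S ∧ ¬ M x := by
    intro x
    by_cases hx : x = a
    · subst hx
      simp [hsta, ha]
    · by_cases hxS : x ∈ S
      · simp [hsta, hx, hxS]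
      · by_cases hxM : M x <;> simp [hsta, hx, hxS, hxM]
  have hpa : p a = a := by simp [hp]
  have hpB : ∀ x ∈ S, x ≠ a → p x = d x := by
    intro x hx hxa; simp [hp, hx, hxa]
  have hpM : ∀ x, M x → p x = a := by
    intro x hx
    have h1 := hMS x hx
    have h2 : x ≠ a := fun h => h1 (h ▸ ha)
    simp only [hp, h1, h2, hx, if_true, if_false]
  have hpC : ∀ x, x ∉ S → ¬ M x → p x = c x := by
    intro x h1 hx
    have h2 : x ≠ a := fun h => h1 (h ▸ ha)
    simp only [hp, h1, h2, hx, if_false]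
  have hMd : ∀ b ∈ S, b ≠ a → M (d b) := fun b hb hba => ⟨b, hb, hba, rfl⟩
  have hreach₁ : ∀ x, M x → p^[1] x = a := fun x hx => hpM x hx
  have hreach₂ : ∀ x ∈ S, p^[2] x = a := by
    intro x hx
    by_cases hxa : x = a
    · simp [hxa, hpa]
    · simp [hpB x hx hxa, hpM _ (hMd x hx hxa)]
  have hreach : ∀ x, ∃ n, p^[n] x = a := by
    intro x
    by_cases hxS : x ∈ S
    · exact ⟨2, hreach₂ x hxS⟩
    by_cases hxM : M x
    · exact ⟨1, hreach₁ x hxM⟩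
    refine ⟨3, ?_⟩
    rw [Function.iterate_succ_apply, hpC x hxS hxM]
    exact hreach₂ _ (hcS x hxS)
  have hpadj : ∀ x, x ≠ a → T.Adj x (p x) := by
    intro x hxa
    by_cases hxS : x ∈ S
    · rw [hpB x hxS hxa]
      exact hbd x hxS hxa
    by_cases hxM : M x
    · rw [hpM x hxM]
      obtain ⟨b, hb, hba, rfl⟩ := hxM
      exact (had b hb hba).symm
    rw [hpC x hxS hxM]
    exact hcadj x hxS
  -- The set `S` together with the middle vertices is a total dominating set, and a vertex of `S`
  -- without leaves could be dropped from it.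
  have hcard : (S ∪ (S.erase a).image d).card + 1 ≤ 2 * S.card := by
    have h1 := Finset.card_union_le S ((S.erase a).image d)
    have h2 : ((S.erase a).image d).card ≤ (S.erase a).card := Finset.card_image_le
    have h3 := Finset.card_erase_add_one ha
    omega
  have hleaf : ∀ s ∈ S, ∃ x, (x ∉ S ∧ ¬ M x) ∧ p x = s := by
    intro s hs
    by_contra! hno
    have hTD : IsTotalDominatingSet T ((S ∪ (S.erase a).image d).erase s) := by
      have hmid : ∀ b ∈ S, b ≠ a → d b ∈ (S ∪ (S.erase a).image d).erase s := by
        intro b hb hba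
        refine Finset.mem_erase.2 ⟨fun h => hd_notMem b hb hba (h ▸ hs), ?_⟩
        exact Finset.mem_union_right _ (Finset.mem_image_of_mem d (Finset.mem_erase.2 ⟨hba, hb⟩))
      have hmem : ∀ y ∈ S, y ≠ s → y ∈ (S ∪ (S.erase a).image d).erase s := fun y hy hys =>
        Finset.mem_erase.2 ⟨hys, Finset.mem_union_left _ hy⟩
      intro x
      by_cases hxa : x = a
      · exact ⟨d b₀, hmid b₀ hb₀ hb₀a, hxa ▸ had b₀ hb₀ hb₀a⟩
      by_cases hxS : x ∈ S
      · exact ⟨d x, hmid x hxS hxa, hbd x hxS hxa⟩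
      by_cases hxM : M x
      · obtain ⟨b, hb, hba, rfl⟩ := hxM
        -- A middle vertex sees both `a` and `b`, so it stays dominated whichever one is dropped.
        by_cases hsa : s = a
        · exact ⟨b, hmem b hb (hsa ▸ hba), (hbd b hb hba).symm⟩
        · exact ⟨a, hmem a ha (Ne.symm hsa), (had b hb hba).symm⟩
      · have := hno x ⟨hxS, hxM⟩
        rw [hpC x hxS hxM] at this
        exact ⟨c x, hmem _ (hcS x hxS) this, hcadj x hxS⟩
    have h1 := totalDominationNumber_le_card hTD
    have h2 := Finset.card_erase_add_one
      (Finset.mem_union_left ((S.erase a).image d) hs)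
    omega
  refine ⟨sta, p, a, ?_⟩
  constructor
  · exact hT.adj_iff_of_reachable
      (fun x hx => hpadj x fun h => hx (by rw [h, hpa])) hreach
  · exact hpa
  · exact hA
  · exact fun x hx => hpM x ((hD x).1 hx)
  · intro x hx
    obtain ⟨hxS, hxa⟩ := (hB x).1 hx
    rw [hpB x hxS hxa]
    exact (hD _).2 (hMd x hxS hxa)
  · intro x hx
    obtain ⟨hxS, hxM⟩ := (hC x).1 hx
    rw [hpC x hxS hxM, hA, hB]
    have := hcS x hxS
    tauto
  · intro x y hx hy h
    obtain ⟨hxS, hxa⟩ := (hB x).1 hx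
    obtain ⟨hyS, hya⟩ := (hB y).1 hy
    rw [hpB x hxS hxa, hpB y hyS hya] at h
    exact hd_inj x hxS hxa y hyS hya h
  · intro x hx
    obtain ⟨b, hb, hba, rfl⟩ := (hD x).1 hx
    exact ⟨b, (hB b).2 ⟨hb, hba⟩, hpB b hb hba⟩
  · intro x hx
    have hxS : x ∈ S := by
      rcases hx with hx | hx
      · exact (hA x).1 hx ▸ ha
      · exact ((hB x).1 hx).1
    obtain ⟨y, hy, hyx⟩ := hleaf x hxS
    exact ⟨y, (hC y).2 hy, hyx⟩
  · exact ⟨d b₀, (hD _).2 (hMd b₀ hb₀ hb₀a)⟩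

end LeafedStar

/-! ### Embeddings of a graph with a path attached -/

section AttachPath

variable {V : Type u} {G : SimpleGraph V} {v : V} {n : ℕ}

@[simp]
theorem attachPath_adj_inl_inl {x y : V} :
    (attachPath G v n).Adj (Sum.inl x) (Sum.inl y) ↔ G.Adj x y := by
  simp [attachPath, SimpleGraph.edge_adj]

@[simp]
theorem attachPath_adj_inl_inr {x : V} {i : Fin (n + 1)} :
    (attachPath G v n).Adj (Sum.inl x) (Sum.inr i) ↔ x = v ∧ i = 0 := by
  simp [attachPath, SimpleGraph.edge_adj, eq_comm]

@[simp]
theorem attachPath_adj_inr_inl {x : V} {i : Fin (n + 1)} :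
    (attachPath G v n).Adj (Sum.inr i) (Sum.inl x) ↔ x = v ∧ i = 0 := by
  rw [SimpleGraph.adj_comm, attachPath_adj_inl_inr]

@[simp]
theorem attachPath_adj_inr_inr {i j : Fin (n + 1)} :
    (attachPath G v n).Adj (Sum.inr i) (Sum.inr j) ↔ (SimpleGraph.pathGraph (n + 1)).Adj i j := by
  simp [attachPath, SimpleGraph.edge_adj]

/-- An embedding of `H` into `G` extends to `H` with a path attached, if the path can be placed
outside of the range of the embedding. -/
theorem exists_attachPath_embedding {W : Type u} {H : SimpleGraph W} (e : H ↪g G) (w : W)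
    (f : Fin (n + 1) → V) (hf : Function.Injective f) (hdisj : ∀ i, f i ∉ Set.range e)
    (hpath : ∀ i j, G.Adj (f i) (f j) ↔ (SimpleGraph.pathGraph (n + 1)).Adj i j)
    (hadj : ∀ x i, G.Adj (e x) (f i) ↔ x = w ∧ i = 0) :
    ∃ e' : attachPath H w n ↪g G, (e' : W ⊕ Fin (n + 1) → V) = Sum.elim e f := by
  refine ⟨⟨⟨Sum.elim e f, ?_⟩, ?_⟩, rfl⟩
  · refine Function.Injective.sumElim e.injective hf fun x i h => hdisj i ⟨x, h⟩
  · rintro (x | i) (y | j)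
    · simp
    · simp [hadj]
    · simp only [Function.Embedding.coeFn_mk, Sum.elim_inl, Sum.elim_inr, attachPath_adj_inr_inl]
      rw [SimpleGraph.adj_comm, hadj]
    · simp [hpath]

end AttachPath

/-! ### Building a leafed subdivided star inside the family -/

section Construction

variable {V : Type u}

/-- The set `U` is the range of an embedding of a member of the family that preserves labels. -/
def IsFamilyT1Range (G : SimpleGraph V) (sta : V → Status) (U : Set V) : Prop :=
  ∃ (W : Type u) (H : SimpleGraph W) (sta' : W → Status) (e : H ↪g G),
    FamilyT1 H sta' ∧ (∀ w, sta (e w) = sta' w) ∧ Set.range e = U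

variable {G : SimpleGraph V} {sta : V → Status} {p : V → V} {a : V}

theorem IsFamilyT1Range.of_range_pathGraph (f : SimpleGraph.pathGraph 5 ↪g G)
    (hf : ∀ i, sta (f i) = ![Status.C, Status.B, Status.D, Status.A, Status.C] i) :
    IsFamilyT1Range G sta (Set.range f) := by
  -- The vertex type must live in `Type u`, so the range of `f` replaces `Fin 5`.
  refine ⟨Set.range f, G.induce (Set.range f), fun x => sta x, SimpleGraph.Embedding.induce _,
    FamilyT1.base f.isoInduceRange fun i => hf i, fun _ => rfl, ?_⟩
  exact Subtype.range_coe

theorem IsFamilyT1Range.familyT1 (h : IsFamilyT1Range G sta Set.univ) : FamilyT1 G sta := by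
  obtain ⟨W, H, sta', e, hH, he, hr⟩ := h
  exact FamilyT1.iso hH (RelIso.ofSurjective e (Set.range_eq_univ.1 hr)) he

theorem IsFamilyT1Range.addLeaf {U : Set V} (h : IsFamilyT1Range G sta U) {v c : V} (hv : v ∈ U)
    (hsv : sta v = Status.A ∨ sta v = Status.B) (hc : c ∉ U) (hsc : sta c = Status.C)
    (hadj : ∀ x ∈ U, G.Adj x c ↔ x = v) : IsFamilyT1Range G sta (insert c U) := by
  obtain ⟨W, H, sta', e, hH, he, rfl⟩ := h
  obtain ⟨w, rfl⟩ := hv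
  have : Subsingleton (Fin (0 + 1)) := inferInstanceAs (Subsingleton (Fin 1))
  obtain ⟨e', he'⟩ := exists_attachPath_embedding (n := 0) e w (fun _ => c)
    (Function.injective_of_subsingleton _) (fun _ => hc)
    (fun i j => by simp [Subsingleton.elim i j])
    (fun x i => by simp [hadj (e x) ⟨x, rfl⟩, Subsingleton.elim i 0])
  refine ⟨_, _, _, e', hH.addLeaf w (by rwa [he] at hsv), ?_, ?_⟩
  · rw [he']
    rintro (x | i)
    · exact he x
    · simpa [Subsingleton.elim i 0] using hsc
  · rw [he', Set.Sum.elim_range, Set.range_const, Set.union_singleton]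

theorem IsFamilyT1Range.addPath {U : Set V} (h : IsFamilyT1Range G sta U) {v : V} (hv : v ∈ U)
    (hsv : sta v = Status.A) {f : Fin 3 → V} (hf : Function.Injective f) (hfU : ∀ i, f i ∉ U)
    (hsf : ∀ i, sta (f i) = ![Status.D, Status.B, Status.C] i)
    (hpath : ∀ i j, G.Adj (f i) (f j) ↔ (SimpleGraph.pathGraph 3).Adj i j)
    (hadj : ∀ x ∈ U, ∀ i, G.Adj x (f i) ↔ x = v ∧ i = 0) :
    IsFamilyT1Range G sta (U ∪ Set.range f) := by
  obtain ⟨W, H, sta', e, hH, he, rfl⟩ := h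
  obtain ⟨w, rfl⟩ := hv
  obtain ⟨e', he'⟩ := exists_attachPath_embedding (n := 2) e w f hf hfU hpath
    (fun x i => by rw [hadj (e x) ⟨x, rfl⟩, e.injective.eq_iff])
  refine ⟨_, _, _, e', hH.addPath w (by rwa [he] at hsv), ?_, ?_⟩
  · rw [he']
    rintro (x | i)
    · exact he x
    · exact hsf i
  · rw [he', Set.Sum.elim_range]

/-- A maximal subset spanning a member of the family is everything: a missing `D` brings a whole new
branch, and then a missing `C` can be added as a leaf. -/
theorem IsLeafedSubdividedStar.familyT1 [Finite V] (h : IsLeafedSubdividedStar G sta p a) :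
    FamilyT1 G sta := by
  have hA := (h.status_eq_A_iff a).2 rfl
  obtain ⟨d, hd⟩ := h.exists_D
  obtain ⟨b, hb, hpb⟩ := h.exists_child_of_D d hd
  obtain ⟨c, hc, hpc⟩ := h.exists_leaf b (Or.inr hb)
  obtain ⟨c', hc', hpc'⟩ := h.exists_leaf a (Or.inl hA)
  have hpd := h.parent_of_D d hd
  have hpa := h.parent_center
  -- Closure under `p` ensures that an outside vertex is joined to `U` only through its own parent.
  -- The last condition puts every `B` in `U` once all `D` are there.
  set Q : Set V → Prop := fun U => IsFamilyT1Range G sta U ∧ a ∈ U ∧ (∀ x ∈ U, p x ∈ U) ∧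
    ∀ x, sta x = Status.B → p x ∈ U → x ∈ U with hQ
  have hbase : Q (Set.range ![c, b, d, a, c']) := by
    have hinj : Function.Injective ![c, b, d, a, c'] := by
      -- The parent's status separates the two leaves `c` and `c'`.
      refine Function.Injective.of_comp (f := fun x => (sta x, sta (p x))) fun i j hij => ?_
      fin_cases i <;> fin_cases j <;> simp [hA, hb, hc, hd, hc', hpa, hpb, hpc, hpc'] at hij ⊢
    refine ⟨?_, ⟨3, rfl⟩, ?_, ?_⟩
    · refine IsFamilyT1Range.of_range_pathGraph ⟨⟨![c, b, d, a, c'], hinj⟩, ?_⟩ ?_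
      · intro i j
        have hne := hinj.eq_iff (a := i) (b := j)
        simp only [Function.Embedding.coeFn_mk, h.adj_iff, SimpleGraph.pathGraph_adj, ne_eq, hne]
        fin_cases i <;> fin_cases j <;> simp [hpc, hpb, hpd, hpa, hpc'] <;> grind
      · intro i
        fin_cases i <;> simp [hA, hb, hc, hd, hc']
    · rintro _ ⟨i, rfl⟩
      fin_cases i
      · exact ⟨1, hpc.symm⟩
      · exact ⟨2, hpb.symm⟩
      · exact ⟨3, hpd.symm⟩
      · exact ⟨3, hpa.symm⟩
      · exact ⟨3, hpc'.symm⟩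
    · rintro x hx ⟨i, hi⟩
      have hD := h.parent_of_B x hx
      rw [← hi] at hD
      refine ⟨1, h.eq_of_parent_eq _ _ hb hx ?_⟩
      fin_cases i
      · exact absurd (hc.symm.trans hD) (by simp)
      · exact absurd (hb.symm.trans hD) (by simp)
      · exact hpb.trans hi
      · exact absurd (hA.symm.trans hD) (by simp)
      · exact absurd (hc'.symm.trans hD) (by simp)
  obtain ⟨U, ⟨hU, haU, hpU, hBU⟩, hmax⟩ :=
    (Set.toFinite {U | Q U}).exists_maximal ⟨_, hbase⟩
  have hDmem : ∀ x, sta x = Status.D → x ∈ U := by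
    intro x hx
    by_contra hxU
    obtain ⟨y, hy, hpy⟩ := h.exists_child_of_D x hx
    obtain ⟨z, hz, hpz⟩ := h.exists_leaf y (Or.inr hy)
    have hpx := h.parent_of_D x hx
    have hyU : y ∉ U := fun hyU => hxU (hpy ▸ hpU y hyU)
    have hzU : z ∉ U := fun hzU => hyU (hpz ▸ hpU z hzU)
    have hinj : Function.Injective ![x, y, z] := by
      refine Function.Injective.of_comp (f := sta) fun i j hij => ?_
      fin_cases i <;> fin_cases j <;> simp [hx, hy, hz] at hij ⊢
    have hout : ∀ i, ![x, y, z] i ∉ U := by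
      intro i
      fin_cases i
      exacts [hxU, hyU, hzU]
    have hnew : Q (U ∪ Set.range ![x, y, z]) := by
      refine ⟨hU.addPath haU hA hinj hout ?_ ?_ ?_, Or.inl haU, ?_, ?_⟩
      · intro i
        fin_cases i <;> simp [hx, hy, hz]
      · intro i j
        rw [h.adj_iff, SimpleGraph.pathGraph_adj, Ne, hinj.eq_iff]
        have h2 := hout 0
        have h3 := hout 1
        have h4 := hout 2
        fin_cases i <;> fin_cases j <;> simp [hpx, hpy, hpz] <;> grind
      · intro u hu i
        rw [h.adj_iff]
        have := hpU u hu
        have h2 := hout i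
        fin_cases i <;> simp [hpx, hpy, hpz] at h2 ⊢ <;> grind
      · rintro u (hu | ⟨i, rfl⟩)
        · exact Or.inl (hpU u hu)
        · fin_cases i
          · exact Or.inl (by simpa [hpx] using haU)
          · exact Or.inr ⟨0, hpy.symm⟩
          · exact Or.inr ⟨1, hpz.symm⟩
      · rintro u hu (hpu | ⟨i, hi⟩)
        · exact Or.inl (hBU u hu hpu)
        · have hD := h.parent_of_B u hu
          rw [← hi] at hD
          refine Or.inr ⟨1, h.eq_of_parent_eq _ _ hy hu ?_⟩
          fin_cases i
          · exact hpy.trans hi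
          · exact absurd (hy.symm.trans hD) (by simp)
          · exact absurd (hz.symm.trans hD) (by simp)
    exact hxU (hmax hnew Set.subset_union_left (Or.inr ⟨0, rfl⟩))
  have hBmem : ∀ x, sta x = Status.B → x ∈ U := fun x hx =>
    hBU x hx (hDmem _ (h.parent_of_B x hx))
  have hAmem : ∀ x, sta x = Status.A → x ∈ U := fun x hx => (h.status_eq_A_iff x).1 hx ▸ haU
  have hCmem : ∀ x, sta x = Status.C → x ∈ U := by
    intro x hx
    by_contra hxU
    have hpx := h.parent_of_C x hx
    have hpxU : p x ∈ U := hpx.elim (hAmem _) (hBmem _)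
    have hnew : Q (insert x U) := by
      refine ⟨hU.addLeaf hpxU hpx hxU hx ?_, Or.inr haU, ?_, ?_⟩
      · intro u hu
        rw [h.adj_iff]
        have := hpU u hu
        grind
      · rintro u (rfl | hu)
        · exact Or.inr hpxU
        · exact Or.inr (hpU u hu)
      · exact fun u hu _ => Or.inr (hBmem u hu)
    exact hxU (hmax hnew (Set.subset_insert x U) (Set.mem_insert x U))
  have hUuniv : U = Set.univ := by
    refine Set.eq_univ_of_forall fun x => ?_
    cases hx : sta x
    exacts [hAmem x hx, hBmem x hx, hCmem x hx, hDmem x hx]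
  exact (hUuniv ▸ hU).familyT1

end Construction

/-! ### Equality for members of the family -/

section LowerBound

/-- Properties of the labelings in the family that determine the total domination number in terms of
the number of vertices of status `B`. -/
structure IsStatusDominated {V : Type*} (G : SimpleGraph V) (sta : V → Status) (a : V) : Prop where
  status_eq_A_iff : ∀ x, sta x = Status.A ↔ x = a
  dominated : ∀ x, sta x = Status.C ∨ sta x = Status.D →
    ∃ s, (sta s = Status.A ∨ sta s = Status.B) ∧ G.Adj x s
  near : ∀ b, sta b = Status.B → ∃ d, G.Adj b d ∧ G.Adj a d
  exists_B : ∃ b, sta b = Status.B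
  exists_leaf : ∀ s, sta s = Status.A ∨ sta s = Status.B →
    ∃ c, sta c = Status.C ∧ ∀ y, G.Adj c y → y = s
  eq_of_adj : ∀ b b' x, sta b = Status.B → sta b' = Status.B → G.Adj b x → G.Adj b' x → b = b'
  status_of_adj : ∀ b x, sta b = Status.B → G.Adj b x → sta x = Status.C ∨ sta x = Status.D

theorem isStatusDominated_pathGraph : IsStatusDominated (SimpleGraph.pathGraph 5)
    ![Status.C, Status.B, Status.D, Status.A, Status.C] 3 := by
  constructor
  · intro x
    fin_cases x <;> simp
  · intro x hx
    fin_cases x <;> simp at hx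
    · exact ⟨1, by simp, by simp [SimpleGraph.pathGraph_adj]⟩
    · exact ⟨1, by simp, by simp [SimpleGraph.pathGraph_adj]⟩
    · exact ⟨3, by simp, by simp [SimpleGraph.pathGraph_adj]⟩
  · intro b hb
    fin_cases b <;> simp at hb
    exact ⟨2, by simp [SimpleGraph.pathGraph_adj], by simp [SimpleGraph.pathGraph_adj]⟩
  · exact ⟨1, rfl⟩
  · intro s hs
    fin_cases s <;> simp at hs
    · exact ⟨0, rfl, fun y => by fin_cases y <;> simp [SimpleGraph.pathGraph_adj]⟩
    · exact ⟨4, rfl, fun y => by fin_cases y <;> simp [SimpleGraph.pathGraph_adj]⟩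
  · intro b b' x hb hb'
    fin_cases b <;> simp at hb
    fin_cases b' <;> simp at hb'
    simp
  · intro b x hb
    fin_cases b <;> simp at hb
    fin_cases x <;> simp [SimpleGraph.pathGraph_adj]

theorem IsStatusDominated.iso {V W : Type*} {G : SimpleGraph V} {H : SimpleGraph W}
    {sta : V → Status} {sta' : W → Status} {a : V} (h : IsStatusDominated G sta a) (e : G ≃g H)
    (he : ∀ v, sta' (e v) = sta v) : IsStatusDominated H sta' (e a) := by
  have hadj : ∀ x y, H.Adj (e x) (e y) ↔ G.Adj x y := fun x y => e.map_adj_iff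
  constructor <;> simp only [e.surjective.forall, e.surjective.exists, he, hadj, e.injective.eq_iff]
  exacts [h.status_eq_A_iff, h.dominated, h.near, h.exists_B, h.exists_leaf, h.eq_of_adj,
    h.status_of_adj]

variable {V : Type u} {G : SimpleGraph V} {sta : V → Status} {a : V}

theorem IsStatusDominated.addLeaf (h : IsStatusDominated G sta a) {v : V}
    (hv : sta v = Status.A ∨ sta v = Status.B) :
    IsStatusDominated (attachPath G v 0) (Sum.elim sta ![Status.C]) (Sum.inl a) := by
  have hnew : ∀ i, (![Status.C] : Fin (0 + 1) → Status) i = Status.C := by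
    intro i; fin_cases i; rfl
  have hzero : ∀ i : Fin (0 + 1), i = 0 := by
    intro i; fin_cases i; rfl
  have hpath : ∀ i j, ¬ (SimpleGraph.pathGraph (0 + 1)).Adj i j := by
    intro i j; fin_cases i; fin_cases j; simp
  constructor <;> simp only [Sum.forall, Sum.exists, Sum.elim_inl, Sum.elim_inr,
    attachPath_adj_inl_inl, attachPath_adj_inl_inr, attachPath_adj_inr_inl, attachPath_adj_inr_inr,
    hnew, hpath, Sum.inl.injEq, reduceCtorEq]
  · simp [h.status_eq_A_iff]
  · refine ⟨fun x hx => Or.inl (h.dominated x hx), fun i _ => Or.inl ⟨v, hv, rfl, hzero i⟩⟩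
  · exact ⟨fun b hb => Or.inl (h.near b hb), by simp⟩
  · exact Or.inl h.exists_B
  · refine ⟨fun s hs => ?_, by simp⟩
    obtain ⟨c, hc, hcs⟩ := h.exists_leaf s hs
    refine Or.inl ⟨c, hc, hcs, ?_⟩
    -- The old leaf `c` has status `C`, so nothing was attached to it.
    rintro i ⟨rfl, -⟩
    simp [hc] at hv
  · refine ⟨fun b => ⟨fun b' => ⟨fun x => h.eq_of_adj b b' x, ?_⟩, by simp⟩, by simp⟩
    rintro i - - ⟨rfl, -⟩ ⟨rfl, -⟩
    rfl
  · exact ⟨fun b => ⟨fun x => h.status_of_adj b x, by simp⟩, by simp⟩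

theorem IsStatusDominated.addPath (h : IsStatusDominated G sta a) {v : V}
    (hv : sta v = Status.A) :
    IsStatusDominated (attachPath G v 2) (Sum.elim sta ![Status.D, Status.B, Status.C])
      (Sum.inl a) := by
  obtain rfl := (h.status_eq_A_iff v).1 hv
  constructor <;> simp only [Sum.forall, Sum.exists, Sum.elim_inl, Sum.elim_inr,
    attachPath_adj_inl_inl, attachPath_adj_inl_inr, attachPath_adj_inr_inl, attachPath_adj_inr_inr,
    Sum.inl.injEq, Sum.inr.injEq, reduceCtorEq]
  · simp [h.status_eq_A_iff, Fin.forall_fin_succ]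
  · refine ⟨fun x hx => Or.inl (h.dominated x hx), fun i hi => ?_⟩
    fin_cases i <;> simp at hi
    · exact Or.inl ⟨v, Or.inl hv, rfl, rfl⟩
    · exact Or.inr ⟨1, by simp, by simp [SimpleGraph.pathGraph_adj]⟩
  · refine ⟨fun b hb => Or.inl (h.near b hb), fun i hi => ?_⟩
    fin_cases i <;> simp at hi
    exact Or.inr ⟨0, by simp [SimpleGraph.pathGraph_adj], by simp⟩
  · exact Or.inl h.exists_B
  · refine ⟨fun s hs => ?_, fun i hi => ?_⟩
    · obtain ⟨c, hc, hcs⟩ := h.exists_leaf s hs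
      refine Or.inl ⟨c, hc, hcs, ?_⟩
      rintro i ⟨rfl, -⟩
      simp [hc] at hv
    · fin_cases i <;> simp at hi
      refine Or.inr ⟨2, rfl, by simp, fun j => ?_⟩
      fin_cases j <;> simp [SimpleGraph.pathGraph_adj]
  · refine ⟨fun b => ⟨fun b' => ⟨fun x => h.eq_of_adj b b' x, ?_⟩, fun i => ⟨?_, ?_⟩⟩,
      fun i => ⟨fun b => ⟨?_, ?_⟩, fun j => ⟨?_, ?_⟩⟩⟩
    · rintro j - - ⟨rfl, -⟩ ⟨rfl, -⟩
      rfl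
    · rintro x - hi - ⟨-, rfl⟩
      simp at hi
    · rintro j hb - ⟨rfl, -⟩
      simp [hv] at hb
    · rintro x hi - ⟨-, rfl⟩
      simp at hi
    · rintro j - hb - ⟨rfl, -⟩
      simp [hv] at hb
    · rintro x hi - ⟨-, rfl⟩
      simp at hi
    · intro k hi hj _ _
      fin_cases i <;> simp at hi
      fin_cases j <;> simp at hj
      rfl
  · refine ⟨fun b => ⟨fun x => h.status_of_adj b x, ?_⟩, fun i => ⟨?_, ?_⟩⟩
    · rintro j hb ⟨rfl, -⟩
      simp [hv] at hb
    · rintro x hi ⟨-, rfl⟩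
      simp at hi
    · intro j hi hij
      fin_cases i <;> simp at hi
      fin_cases j <;> simp [SimpleGraph.pathGraph_adj] at hij ⊢

theorem FamilyT1.exists_isStatusDominated (h : FamilyT1 G sta) :
    ∃ a, IsStatusDominated G sta a := by
  induction h with
  | base e he => exact ⟨_, isStatusDominated_pathGraph.iso e he⟩
  | addLeaf _ v hv ih =>
    obtain ⟨a, ha⟩ := ih
    exact ⟨_, ha.addLeaf hv⟩
  | addPath _ v hv ih =>
    obtain ⟨a, ha⟩ := ih
    exact ⟨_, ha.addPath hv⟩
  | iso _ e he ih =>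
    obtain ⟨a, ha⟩ := ih
    exact ⟨_, ha.iso e he⟩

/-- With `B` the set of vertices of status `B`, `insert a B` is semitotal dominating, while a total
dominating set contains `insert a B` and a disjoint set of `|B|` neighbours. -/
theorem IsStatusDominated.two_mul_semitotalDominationNumber_le [Finite V]
    (h : IsStatusDominated G sta a) (hG : ∀ v, ∃ w, G.Adj v w) :
    2 * semitotalDominationNumber G ≤ totalDominationNumber G + 1 := by
  classical
  have := Fintype.ofFinite V
  set B : Finset V := Finset.univ.filter fun x => sta x = Status.B with hB
  have hmemB : ∀ x, x ∈ B ↔ sta x = Status.B := by simp [hB]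
  have hA : sta a = Status.A := (h.status_eq_A_iff a).2 rfl
  have haB : a ∉ B := by simp [hmemB, hA]
  have hmem : ∀ x, x ∈ insert a B ↔ sta x = Status.A ∨ sta x = Status.B := by
    simp [hmemB, h.status_eq_A_iff]
  have hne : ∀ b, sta b = Status.B → b ≠ a := by
    rintro b hb rfl
    exact haB ((hmemB b).2 hb)
  have hsemi : IsSemitotalDominatingSet G (insert a B) := by
    refine ⟨fun x hx => ?_, fun x hx => ?_⟩
    · simp only [hmem] at hx ⊢
      refine h.dominated x ?_
      cases hs : sta x <;> simp [hs] at hx ⊢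
    · rcases (hmem x).1 hx with hx | hx
      · obtain rfl := (h.status_eq_A_iff x).1 hx
        obtain ⟨b, hb⟩ := h.exists_B
        obtain ⟨d, hbd, had⟩ := h.near b hb
        exact ⟨b, (hmem b).2 (Or.inr hb), hne b hb,
          (edist_le_two_iff (hne b hb).symm).2 (Or.inr ⟨d, had, hbd⟩)⟩
      · obtain ⟨d, hxd, had⟩ := h.near x hx
        exact ⟨a, (hmem a).2 (Or.inl hA), (hne x hx).symm,
          (edist_le_two_iff (hne x hx)).2 (Or.inr ⟨d, hxd, had⟩)⟩
  have h1 := semitotalDominationNumber_le_card hsemi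
  obtain ⟨D, hD, hcard⟩ := exists_isTotalDominatingSet_card_eq hG
  choose f hfD hf using hD
  -- Only `s` can dominate a leaf hanging from `s`.
  have hsub : insert a B ⊆ D := by
    intro s hs
    obtain ⟨c, -, hc⟩ := h.exists_leaf s ((hmem s).1 hs)
    exact hc _ (hf c) ▸ hfD c
  have himg : B.image f ⊆ D := by
    simp only [Finset.image_subset_iff]
    exact fun b _ => hfD b
  have hdisj : Disjoint (insert a B) (B.image f) := by
    rw [Finset.disjoint_right]
    intro x hx hx'
    obtain ⟨b, hb, rfl⟩ := Finset.mem_image.1 hx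
    have h2 := h.status_of_adj b (f b) ((hmemB b).1 hb) (hf b)
    have h3 := (hmem _).1 hx'
    rcases h2 with h2 | h2 <;> simp [h2] at h3
  have hinj : (B.image f).card = B.card := by
    refine Finset.card_image_of_injOn fun b hb b' hb' hbb' => ?_
    have h2 := hf b'
    rw [← hbb'] at h2
    exact h.eq_of_adj b b' (f b) ((hmemB b).1 hb) ((hmemB b').1 hb') (hf b) h2
  have h4 := Finset.card_le_card (Finset.union_subset hsub himg)
  rw [Finset.card_union_of_disjoint hdisj, hinj] at h4
  rw [Finset.card_insert_of_notMem haB] at h1 h4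
  omega

end LowerBound

theorem theorem3p2 {V : Type u} [Finite V] [Nontrivial V] (T : SimpleGraph V) (hT : T.IsTree) :
    (totalDominationNumber T : ℤ) ≤ 2 * (semitotalDominationNumber T : ℤ) - 1 ∧
    ((totalDominationNumber T : ℤ) = 2 * (semitotalDominationNumber T : ℤ) - 1 ↔
      ∃ sta : V → Status, FamilyT1 T sta) := by
  have hG : ∀ v, ∃ w, T.Adj v w := hT.connected.preconnected.exists_adj_of_nontrivial
  have hlt := totalDominationNumber_lt_two_mul_semitotalDominationNumber hG
  refine ⟨by omega, fun heq => ?_, ?_⟩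
  · obtain ⟨S, hS, hcard⟩ := exists_isSemitotalDominatingSet_card_eq hG
    obtain ⟨sta, p, a, h⟩ := hS.exists_isLeafedSubdividedStar hT hG (by omega)
    exact ⟨sta, h.familyT1⟩
  · rintro ⟨sta, hsta⟩
    obtain ⟨a, ha⟩ := hsta.exists_isStatusDominated
    have := ha.two_mul_semitotalDominationNumber_le hG
    omega
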